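/- A \emph{Stirling permutation} of order $n\ge 0$ is an arrangement $\sigma$ of the multiset $\{1,1,2,2,\ldots,n,n\}$ in which, for every $i$, all entries between the two occurrences of $i$ are larger than $i$; let $\mathcal{Q}_n$ be their set. Let $\Phi(\sigma)$ be obtained from $\sigma$ by replacing, for each $j$, the first occurrence of $j$ by $2j$ and the second one by $2j-1$; the elements of $\Phi(\mathcal{Q}_n)$ are the \emph{dual Stirling permutations} of order $n$. For a word $w$ of distinct numbers let ${\rm altrun}(w)$ be its number of alternating runs, i.e. of maximal consecutive increasing or decreasing subsequences with at least two terms, and let ${\rm udrun}(w)$ be the number of alternating runs of $0w$. Put $$F_n(x)=\sum_{\pi\in\Phi(\mathcal{Q}_n)}x^{{\rm altrun}(\pi)},\qquad T_n(x)=\sum_{\pi\in\mathfrak{S}_n}x^{{\rm udrun}(\pi)},\qquad T(x,z)=\sum_{n\ge 0}T_n(x)\frac{z^n}{n!}.$$ A polynomial is \emph{semi-$\gamma$-positive} if it equals $(1+x)^\nu\sum_{k=0}^{m}\lambda_kx^k(1+x^2)^{m-k}$ for some $m\ge 0$, $\nu\in\{0,1\}$ and $\lambda_0,\ldots,\lambda_m\ge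 0$. \textbf{Theorem.} For every $n\ge 0$ the polynomial $F_n(x)$ is semi-$\gamma$-positive. More precisely, there are numbers $f_{n,k}\ge 0$ ($n\ge 0$, $k\in\mathbb{Z}$), with $f_{n,k}=0$ unless $0\le k\le n$, such that $$F_n(x)=\sum_{k=0}^{n}f_{n,k}x^k(1+x^2)^{n-k}\qquad(n\ge 0),$$ $$f_{n+1,k}=kf_{n,k}+f_{n,k-1}+4(n-k+2)f_{n,k-2}\qquad(n\ge 0,\ k\in\mathbb{Z}),$$ with $f_{0,0}=1$ and $f_{n,0}=0$ for $n\ge 1$. Moreover, with $f_n(x)=\sum_{k=0}^{n}f_{n,k}x^k$, $$\sum_{n\ge 0}f_n(x)\frac{z^n}{n!}=\sqrt{T(2x,z)}$$ as formal power series in $z$ (the square root with constant term $1$), where, with $\rho=\sqrt{1-x^2}$ (the power series in $x$ with constant term $1$), as formal power series in $x$ and $z$, $$T(x,z)=(1-x)\,\frac{1+\rho+2xe^{\rho z}+(1-\rho)e^{2\rho z}}{1+\rho-x^2+(1-\rho-x^2)e^{2\rho z}}.$$ -/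

import Mathlib

open scoped Nat

noncomputable section

namespace DualStirling

open Polynomial

/-- The factor `w_i w_{i+1} ⋯ w_j` (positions counted from `0`) of the word `w` has at least two
letters and is increasing or decreasing. -/
def IsMonotoneFactor (w : List ℕ) (i j : ℕ) : Prop :=
  i < j ∧ j < w.length ∧
    ((∀ p, i ≤ p → p < j → w.getD p 0 < w.getD (p + 1) 0) ∨
      (∀ p, i ≤ p → p < j → w.getD (p + 1) 0 < w.getD p 0))

/-- The factor `w_i ⋯ w_j` is an alternating run of `w`: an increasing or decreasing factor that is
contained in no other one. -/
def IsAlternatingRun (w : List ℕ) (i j : ℕ) : Prop :=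
  IsMonotoneFactor w i j ∧
    ∀ i' j', i' ≤ i → j ≤ j' → IsMonotoneFactor w i' j' → i' = i ∧ j' = j

open Classical in
/-- The number of alternating runs of a word. -/
def altrun (w : List ℕ) : ℕ :=
  ((Finset.range w.length ×ˢ Finset.range w.length).filter
    fun p => IsAlternatingRun w p.1 p.2).card

/-- The number of up-down runs: the alternating runs of the word with a `0` put in front. -/
def udrun (w : List ℕ) : ℕ := altrun (0 :: w)

/-- The permutations of `{1, …, n}` in one-line notation. -/
def perms (n : ℕ) : Finset (List ℕ) := (Finset.Icc 1 n).val.lists.toFinset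

/-- The up-down run polynomial `T_n(x) = ∑_{π ∈ S_n} x^{udrun π}`. -/
def T (n : ℕ) : ℚ[X] := ∑ w ∈ perms n, X ^ udrun w

/-- The multiset `{1, 1, 2, 2, …, n, n}`. -/
def doubledMultiset (n : ℕ) : Multiset ℕ := (Finset.Icc 1 n).val + (Finset.Icc 1 n).val

open Classical in
/-- The Stirling permutations of order `n`: the arrangements of `{1, 1, …, n, n}` in which every
letter `a` that stands between the two occurrences of `i`, that is, every `a` for which `i a i` is
a subsequence, is larger than `i`. -/
def stirlingPerms (n : ℕ) : Finset (List ℕ) :=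
  (doubledMultiset n).lists.toFinset.filter
    fun σ => ∀ i a : ℕ, List.Sublist [i, a, i] σ → i < a

/-- The map `Φ`: the first occurrence of a letter `j` becomes `2j`, the second one `2j - 1`. -/
def Phi (σ : List ℕ) : List ℕ :=
  σ.mapIdx fun p j => if j ∈ σ.take p then 2 * j - 1 else 2 * j

/-- The dual Stirling permutations of order `n`. -/
def dualStirlingPerms (n : ℕ) : Finset (List ℕ) := (stirlingPerms n).image Phi

/-- The alternating run polynomial `F_n(x)` of the dual Stirling permutations of order `n`. -/
def F (n : ℕ) : ℚ[X] := ∑ w ∈ dualStirlingPerms n, X ^ altrun w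

/-- Semi-`γ`-positivity: `f(x) = (1+x)^ν ∑_{k=0}^n λ_k x^k (1+x²)^{n-k}` with `ν ∈ {0, 1}` and all
`λ_k ≥ 0`. -/
def IsSemiGammaPositive (f : ℚ[X]) : Prop :=
  ∃ (ν n : ℕ) (c : ℕ → ℚ), (ν = 0 ∨ ν = 1) ∧ (∀ k ≤ n, 0 ≤ c k) ∧
    f = (1 + X) ^ ν * ∑ k ∈ Finset.range (n + 1), C (c k) * X ^ k * (1 + X ^ 2) ^ (n - k)

/-- The exponential generating function `∑_n p_n(x) zⁿ/n!`, a formal power series in `z` whose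
coefficients are polynomials in `x`. -/
def egf (p : ℕ → ℚ[X]) : PowerSeries ℚ[X] := PowerSeries.mk fun n => C ((n ! : ℚ)⁻¹) * p n

/-- `g(x, z) ↦ g(2x, z)`. -/
def substTwoX : PowerSeries ℚ[X] →+* PowerSeries ℚ[X] :=
  PowerSeries.map (Polynomial.compRingHom (2 * X))

/-- Polynomials in `x` regarded as power series in `x`, coefficientwise in `z`. -/
def toSeries : PowerSeries ℚ[X] →+* PowerSeries (PowerSeries ℚ) :=
  PowerSeries.map (Polynomial.coeToPowerSeries.ringHom)

/-- `ρ = √(1 - x²)` as a power series in `x`, by the binomial series. -/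
def rho : PowerSeries ℚ :=
  (PowerSeries.binomialSeries ℚ (1 / 2 : ℚ)).subst (-(PowerSeries.X ^ 2 : PowerSeries ℚ))

/-- `x` as an element of `ℚ⟦x⟧⟦z⟧`. -/
def xx : PowerSeries (PowerSeries ℚ) := PowerSeries.C PowerSeries.X

/-- `ρ` as an element of `ℚ⟦x⟧⟦z⟧`. -/
def rr : PowerSeries (PowerSeries ℚ) := PowerSeries.C rho

/-- `e^{az} = ∑ aⁿ zⁿ / n!` in `ℚ⟦x⟧⟦z⟧`, for `a ∈ ℚ⟦x⟧`. -/
def expz (a : PowerSeries ℚ) : PowerSeries (PowerSeries ℚ) :=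
  PowerSeries.rescale a (PowerSeries.exp (PowerSeries ℚ))

/-- The numerator `(1-x)(1 + ρ + 2x e^{ρz} + (1-ρ) e^{2ρz})`. -/
def stanleyNum : PowerSeries (PowerSeries ℚ) :=
  (1 - xx) * (1 + rr + 2 * xx * expz rho + (1 - rr) * expz (2 * rho))

/-- The denominator `1 + ρ - x² + (1 - ρ - x²) e^{2ρz}`. -/
def stanleyDen : PowerSeries (PowerSeries ℚ) :=
  1 + rr - xx ^ 2 + (1 - rr - xx ^ 2) * expz (2 * rho)

theorem rho_sq : rho ^ 2 = 1 - PowerSeries.X ^ 2 := by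
  have h : PowerSeries.HasSubst (-(PowerSeries.X ^ 2 : PowerSeries ℚ)) :=
    PowerSeries.HasSubst.of_constantCoeff_zero' (by simp)
  have h2 : (PowerSeries.binomialSeries ℚ (1 / 2 : ℚ)) ^ 2 = 1 + PowerSeries.X := by
    rw [pow_two, ← PowerSeries.binomialSeries_add]
    have := PowerSeries.binomialSeries_nat (R := ℚ) (A := ℚ) 1
    norm_num at this ⊢
    exact this
  rw [rho, ← PowerSeries.subst_pow h, h2, PowerSeries.subst_add h, PowerSeries.subst_X h,
    ← PowerSeries.coe_substAlgHom h, map_one, sub_eq_add_neg]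

theorem constantCoeff_rho : PowerSeries.constantCoeff rho = 1 := by
  have h0 : PowerSeries.constantCoeff (-(PowerSeries.X ^ 2 : PowerSeries ℚ)) = 0 := by simp
  have h : PowerSeries.HasSubst (-(PowerSeries.X ^ 2 : PowerSeries ℚ)) :=
    PowerSeries.HasSubst.of_constantCoeff_zero' h0
  have h1 : PowerSeries.binomialSeries ℚ (1 / 2 : ℚ) =
      (PowerSeries.binomialSeries ℚ (1 / 2 : ℚ) - 1) + 1 := by ring
  have h2 := PowerSeries.constantCoeff_subst_eq_zero (S := ℚ) h0
    (PowerSeries.binomialSeries ℚ (1 / 2 : ℚ) - 1) (by simp)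
  rw [rho, h1, PowerSeries.subst_add h, map_add]
  erw [h2]
  rw [← PowerSeries.coe_substAlgHom h, map_one]
  simp

/-- The denominator is invertible in `ℚ⟦x⟧⟦z⟧`, so the quotient makes sense. -/
theorem isUnit_stanleyDen : IsUnit stanleyDen := by
  rw [PowerSeries.isUnit_iff_constantCoeff, PowerSeries.isUnit_iff_constantCoeff]
  simp [stanleyDen, xx, rr, expz, constantCoeff_rho]

/-- The closed form `(1-x)(1+ρ+2x e^{ρz}+(1-ρ)e^{2ρz}) / (1+ρ-x²+(1-ρ-x²)e^{2ρz})`. -/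
def stanleyT : PowerSeries (PowerSeries ℚ) :=
  stanleyNum * ↑(isUnit_stanleyDen.unit⁻¹)

end DualStirling

end

open scoped Nat

noncomputable section

namespace DualStirling

open Polynomial

/-! Both families grow by inserting largest letters. If `w` has `n` letters and `0w` has `r` runs, a
new maximum put into one of the `n + 1` slots after `0` keeps `r` in `r` cases, raises it by 1 in
one case and by 2 in the other `n - r`. Hence `T_{n+1} = L_n T_n` with `L_n g = x(1+nx)g +
x(1-x²)g'` (`insertionOp`, `T_succ`). A dual Stirling permutation grows by the block `(2n+2)(2n+1)`
and, if nonempty, ends with a descent. Appending `0` and reversing turns this into the insertion of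
one maximum into a word headed by `0`, so `F_{n+1} = L_{2n} F_n` (`F_succ`).

On the basis `x^k (1+x²)^{n-k}` the operator `L_{2n}` acts by the three-term recurrence
(`sum_fcoeff_eq`), whose factor `4(n-k+2)` is negative only where `f_{n,k-2} = 0` (`fcoeff_nonneg`).

For the generating functions, a recurrence `p_{n+1} = (c+nb)p_n + δ p_n` says that the exponential
generating function `g` satisfies `D g = c g` for the derivation `D = (1-bz)∂_z - δ`, and such a `g`
is determined by its value at `z = 0` (`transport_unique`). For one and the same `D`, the series of
the `f_n` has `c = x` and `T(2x,z)` has `c = 2x`. Squaring doubles `c`, so the square of the first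
is the second. The closed form is checked against the equation of `T(x,z)` by the quotient rule
(`stanleyOp_stanleyT`). -/

/-! ### Alternating runs as a sum of turns -/

/-- `0` if `a, b, c` is monotone, and `1` if it has a peak or valley at `b`. -/
def turn (a b c : ℕ) : ℕ := if (a < b ↔ b < c) then 0 else 1

/-- The number of alternating runs of a word without equal neighbours, computed recursively. -/
def runs : List ℕ → ℕ
  | [] => 0
  | [_] => 0
  | [_, _] => 1
  | a :: b :: c :: l => runs (b :: c :: l) + turn a b c

/-- The word has an ascent at position `i`. -/
def AscentAt (w : List ℕ) (i : ℕ) : Prop := w.getD i 0 < w.getD (i + 1) 0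

/-- A new alternating run starts at position `i`. -/
def IsRunStart (w : List ℕ) (i : ℕ) : Prop :=
  i = 0 ∨ ¬ (AscentAt w (i - 1) ↔ AscentAt w i)

/-- Distinct neighbours make every non-ascent a descent, so one predicate serves both directions. -/
theorem isMonotoneFactor_iff {w : List ℕ} (hw : w.IsChain (· ≠ ·)) (i j : ℕ) :
    IsMonotoneFactor w i j ↔ i < j ∧ j < w.length ∧
      ((∀ p, i ≤ p → p < j → AscentAt w p) ∨ (∀ p, i ≤ p → p < j → ¬ AscentAt w p)) := by
  refine and_congr_right fun _ => and_congr_right fun hj => or_congr Iff.rfl ?_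
  refine forall_congr' fun p => forall_congr' fun _ => forall_congr' fun hp => ?_
  have hne : w.getD p 0 ≠ w.getD (p + 1) 0 := by
    have := List.isChain_iff_getElem.1 hw p (by omega)
    rwa [List.getD_eq_getElem _ _ (by omega), List.getD_eq_getElem _ _ (by omega)]
  unfold AscentAt
  omega

-- A run is determined by its first position, which is `0` or a place where the direction changes.
open Classical in
theorem altrun_eq_card_starts {w : List ℕ} (hw : w.IsChain (· ≠ ·)) :
    altrun w = ((Finset.range (w.length - 1)).filter (IsRunStart w)).card := by
  unfold altrun
  refine Finset.card_bij (fun p _ => p.1) ?_ ?_ ?_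
  · rintro ⟨i, j⟩ h
    simp only [Finset.mem_filter, Finset.mem_product, Finset.mem_range] at h ⊢
    obtain ⟨-, hm, hmax⟩ := h
    have hm' := (isMonotoneFactor_iff hw i j).1 hm
    refine ⟨by omega, ?_⟩
    by_contra hs
    simp only [IsRunStart, not_or, not_not] at hs
    obtain ⟨h0, hs⟩ := hs
    have : IsMonotoneFactor w (i - 1) j := by
      rw [isMonotoneFactor_iff hw]
      refine ⟨by omega, hm'.2.1, hm'.2.2.imp ?_ ?_⟩
      · intro h p hp hpj
        rcases Nat.lt_or_ge p i with h1 | h1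
        · obtain rfl : p = i - 1 := by omega
          exact hs.2 (h i le_rfl hm'.1)
        · exact h p h1 hpj
      · intro h p hp hpj
        rcases Nat.lt_or_ge p i with h1 | h1
        · obtain rfl : p = i - 1 := by omega
          exact fun h' => h i le_rfl hm'.1 (hs.1 h')
        · exact h p h1 hpj
    have := (hmax (i - 1) j (by omega) le_rfl this).1
    omega
  · rintro ⟨i, j⟩ h ⟨i', j'⟩ h' (rfl : i = i')
    simp only [Finset.mem_filter] at h h'
    rcases le_total j j' with hj | hj
    · rw [(h.2.2 i j' le_rfl hj h'.2.1).2]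
    · rw [(h'.2.2 i j le_rfl hj h.2.1).2]
  · intro i hi
    simp only [Finset.mem_filter, Finset.mem_range] at hi
    obtain ⟨hi, hs⟩ := hi
    have h1 : IsMonotoneFactor w i (i + 1) := by
      rw [isMonotoneFactor_iff hw]
      refine ⟨by omega, by omega, ?_⟩
      by_cases ha : AscentAt w i
      · refine Or.inl fun p h1 h2 => ?_
        obtain rfl : p = i := by omega
        exact ha
      · refine Or.inr fun p h1 h2 => ?_
        obtain rfl : p = i := by omega
        exact ha
    -- The run starting at `i` is the monotone factor from `i` with the farthest end.
    have hm := Nat.findGreatest_spec (P := fun j => IsMonotoneFactor w i j)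
      (n := w.length) (by omega) h1
    have hg : ∀ j', IsMonotoneFactor w i j' →
        j' ≤ Nat.findGreatest (fun j => IsMonotoneFactor w i j) w.length := fun j' hj' =>
      Nat.le_findGreatest hj'.2.1.le hj'
    set j := Nat.findGreatest (fun j => IsMonotoneFactor w i j) w.length
    refine ⟨(i, j), ?_, rfl⟩
    simp only [Finset.mem_filter, Finset.mem_product, Finset.mem_range]
    refine ⟨⟨by omega, hm.2.1⟩, hm, fun i' j' hi' hj' h => ?_⟩
    have h2 := (isMonotoneFactor_iff hw i' j').1 h
    have hij : i < j := hm.1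
    have h3 : IsMonotoneFactor w i j' := ⟨by omega, h.2.1,
      h.2.2.imp (fun h p hp => h p (by omega)) (fun h p hp => h p (by omega))⟩
    refine ⟨?_, le_antisymm (hg j' h3) hj'⟩
    by_contra hne
    rcases hs with hs | hs
    · omega
    · refine hs ?_
      rcases h2.2.2 with h | h
      · exact iff_of_true (h _ (by omega) (by omega)) (h _ (by omega) (by omega))
      · exact iff_of_false (h _ (by omega) (by omega)) (h _ (by omega) (by omega))

open Classical in
theorem card_starts_eq_runs (w : List ℕ) :
    ((Finset.range (w.length - 1)).filter (IsRunStart w)).card = runs w := by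
  induction w using runs.induct with
  | case1 => simp [runs]
  | case2 a => simp [runs]
  | case3 a b => simp [runs, IsRunStart, Finset.filter_singleton]
  | case4 a b c l ih =>
    rw [runs, ← ih, Finset.card_filter, Finset.card_filter]
    simp only [List.length_cons, Nat.add_sub_cancel]
    rw [Finset.sum_range_succ', Finset.sum_range_succ', Finset.sum_range_succ']
    have h0 : ∀ w, IsRunStart w 0 := fun w => Or.inl rfl
    have h1 : IsRunStart (a :: b :: c :: l) (0 + 1) ↔ ¬ (a < b ↔ b < c) := by
      simp [IsRunStart, AscentAt]
    have h2 : ∀ i, IsRunStart (a :: b :: c :: l) (i + 1 + 1) ↔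
        IsRunStart (b :: c :: l) (i + 1) := fun i => by
      simp [IsRunStart, AscentAt]
    simp only [h0, h1, h2, turn, if_true]
    by_cases h : a < b ↔ b < c <;> simp [h]

theorem altrun_eq_runs {w : List ℕ} (hw : w.IsChain (· ≠ ·)) : altrun w = runs w := by
  rw [altrun_eq_card_starts hw, card_starts_eq_runs]

theorem runs_append_three (l : List ℕ) (a b c : ℕ) :
    runs (l ++ [a, b, c]) = runs (l ++ [a, b]) + turn a b c := by
  induction l using runs.induct with
  | case1 => simp [runs]
  | case2 x => simp [runs]; omega
  | case3 x y => simp [runs]; omega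
  | case4 x y z l ih =>
    simp only [List.cons_append, runs] at ih ⊢
    omega

theorem turn_comm {a b c : ℕ} (h1 : a ≠ b) (h2 : b ≠ c) : turn c b a = turn a b c := by
  have : (c < b ↔ b < a) ↔ (a < b ↔ b < c) := by omega
  simp [turn, this]

theorem runs_reverse {w : List ℕ} (hw : w.IsChain (· ≠ ·)) : runs w.reverse = runs w := by
  induction w using runs.induct with
  | case1 => rfl
  | case2 => rfl
  | case3 => rfl
  | case4 a b c l ih =>
    simp only [List.isChain_cons_cons] at hw ih
    have := runs_append_three l.reverse c b a
    simp only [List.reverse_cons, List.append_assoc, List.cons_append, List.nil_append] at ih ⊢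
    rw [this, ih hw.2, runs, turn_comm hw.1 hw.2.1]

/-! ### Effect of an insertion on the number of runs -/

/-- Insert the block `B` after the first `p` letters of `w`. -/
def insertAt (B : List ℕ) (p : ℕ) (w : List ℕ) : List ℕ := w.take p ++ B ++ w.drop p

@[simp] theorem insertAt_zero (B w : List ℕ) : insertAt B 0 w = B ++ w := by simp [insertAt]

@[simp] theorem insertAt_cons_succ (B w : List ℕ) (a p : ℕ) :
    insertAt B (p + 1) (a :: w) = a :: insertAt B p w := by simp [insertAt]

/-- The distribution of `runs` over the insertions of `M` after at least two letters. -/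
theorem sum_runs_insertAt_two (M : ℕ) (l : List ℕ) (z a b : ℕ) :
    ∑ p ∈ Finset.range (l.length + 2), (X : ℚ[X]) ^ runs (insertAt [M] (p + 2) (z :: a :: b :: l)) =
      X ^ runs (z :: a :: M :: b :: l) + X ^ turn z a b *
        ∑ p ∈ Finset.range (l.length + 1), X ^ runs (insertAt [M] (p + 2) (a :: b :: l)) := by
  rw [Finset.sum_range_succ', Finset.mul_sum, add_comm]
  refine congrArg₂ _ (by simp) ?_
  · refine Finset.sum_congr rfl fun p _ => ?_
    have : runs (insertAt [M] (p + 1 + 2) (z :: a :: b :: l)) =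
        runs (insertAt [M] (p + 2) (a :: b :: l)) + turn z a b := by
      simp only [insertAt_cons_succ, runs]
    rw [this, pow_add, mul_comm]

theorem turn_eq_zero {a b c : ℕ} (h : a < b ↔ b < c) : turn a b c = 0 := if_pos h

theorem turn_eq_one {a b c : ℕ} (h : ¬ (a < b ↔ b < c)) : turn a b c = 1 := if_neg h

theorem runs_pos (a b : ℕ) (l : List ℕ) : 1 ≤ runs (a :: b :: l) := by
  induction l generalizing a b with
  | nil => simp [runs]
  | cons c l ih => rw [runs]; have := ih b c; omega

/-- Induction peels off the first letter, so words beginning with a descent must be covered too. For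
an initial ascent the correction term accounts for the slot between `a` and `b`, which the sum
leaves out. -/
theorem sum_runs_insertAt_aux (M : ℕ) (l : List ℕ) : ∀ a b : ℕ,
    (a :: b :: l).IsChain (· ≠ ·) → (∀ x ∈ a :: b :: l, x < M) →
    ∑ p ∈ Finset.range (l.length + 1), (X : ℚ[X]) ^ runs (insertAt [M] (p + 2) (a :: b :: l)) =
      X ^ (runs (a :: b :: l) + 1) + (((runs (a :: b :: l) : ℕ) : ℚ[X]) - 1) * X ^ runs (a :: b :: l)
        + ((l.length : ℚ[X]) + 1 - ((runs (a :: b :: l) : ℕ) : ℚ[X])) * X ^ (runs (a :: b :: l) + 2)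
        + if a < b then X ^ runs (a :: b :: l) - X ^ runs (a :: M :: b :: l) else 0 := by
  induction l with
  | nil =>
    intro a b hne hM
    have ha : a < M := hM a (by simp)
    have hb : b < M := hM b (by simp)
    have hab : a ≠ b := by simpa using hne
    rcases lt_or_gt_of_ne hab with h | h
    · simp [runs, insertAt, turn, h, ha, hb, hb.not_gt]
    · simp [runs, insertAt, turn, h.not_gt, hb]
  | cons c l ih =>
    intro a b hne hM
    have ha : a < M := hM a (by simp)
    have hb : b < M := hM b (by simp)
    have hc : c < M := hM c (by simp)
    obtain ⟨hab, hne'⟩ := List.isChain_cons_cons.1 hne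
    have hbc : b ≠ c := (List.isChain_cons_cons.1 hne').1
    have := ih b c hne' fun x hx => hM x (List.mem_cons_of_mem _ hx)
    have hsum := sum_runs_insertAt_two M l a b c
    rw [List.length_cons, hsum, this]
    have e1 : runs (a :: b :: c :: l) = runs (b :: c :: l) + turn a b c := rfl
    have e2 : runs (a :: b :: M :: c :: l) = runs (b :: M :: c :: l) + turn a b M := rfl
    have e3 : runs (a :: M :: b :: c :: l) =
      runs (b :: c :: l) + turn M b c + turn a M b := rfl
    have e4 : turn a M b = 1 := turn_eq_one (by omega)
    have e5 : runs (b :: M :: c :: l) = runs (M :: c :: l) + 1 := by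
      rw [runs, turn_eq_one (by omega)]
    have e6 : b > c → runs (M :: c :: l) = runs (b :: c :: l) := by
      intro h
      cases l with
      | nil => rfl
      | cons d l => simp only [runs, turn, hc.not_gt, h.not_gt]
    obtain ⟨r, hr⟩ := Nat.exists_eq_add_of_le' (runs_pos b c l)
    rw [e1, e2, e3, e4, hr]
    rcases lt_or_gt_of_ne hab with h | h <;> rcases lt_or_gt_of_ne hbc with h' | h'
    · rw [turn_eq_zero (a := a) (b := b) (c := c) (by omega), turn_eq_zero (a := a) (c := M) (by omega),
        turn_eq_one (a := M) (by omega), if_pos h, if_pos h']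
      push_cast
      ring
    · rw [turn_eq_one (a := a) (b := b) (c := c) (by omega), turn_eq_zero (a := a) (c := M) (by omega),
        turn_eq_zero (a := M) (by omega), if_pos h, if_neg h'.not_gt, e5, e6 h', hr]
      push_cast
      ring
    · rw [turn_eq_one (a := a) (b := b) (c := c) (by omega), turn_eq_one (a := a) (c := M) (by omega),
        if_neg h.not_gt, if_pos h']
      push_cast
      ring
    · rw [turn_eq_zero (a := a) (b := b) (c := c) (by omega), turn_eq_one (a := a) (c := M) (by omega),
        if_neg h.not_gt, if_neg h'.not_gt, e5, e6 h', hr]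
      push_cast
      ring

/-- The two slots next to an interior peak preserve the number of runs, as does the end slot after a
final ascent: `r` slots in all. One slot adds 1: the last but one after a final ascent, the last
after a final descent. Every other slot creates a new peak and a new valley. -/
theorem sum_runs_insertAt_zero_cons {M : ℕ} {w : List ℕ} (hne : (0 :: w).IsChain (· ≠ ·))
    (hM : ∀ x ∈ 0 :: w, x < M) :
    ∑ p ∈ Finset.range (w.length + 1), (X : ℚ[X]) ^ runs (0 :: insertAt [M] p w) =
      X ^ (runs (0 :: w) + 1) + ((runs (0 :: w) : ℕ) : ℚ[X]) * X ^ runs (0 :: w)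
        + ((w.length : ℚ[X]) - ((runs (0 :: w) : ℕ) : ℚ[X])) * X ^ (runs (0 :: w) + 2) := by
  cases w with
  | nil => simp [runs, insertAt]
  | cons b l =>
    have h := sum_runs_insertAt_aux M l 0 b hne hM
    -- The word starts with an ascent, so the correction cancels against the slot right after `0`.
    have hb : 0 < b := by
      have := (List.isChain_cons_cons.1 hne).1
      omega
    rw [if_pos hb] at h
    simp only [insertAt_cons_succ] at h
    rw [List.length_cons, Finset.sum_range_succ']
    simp only [insertAt_cons_succ]
    rw [h]
    simp
    ring

/-- The common right-hand side of the two insertion recurrences. -/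
def insertionOp (n : ℕ) (f : ℚ[X]) : ℚ[X] :=
  X * (1 + (n : ℚ[X]) * X) * f + X * (1 - X ^ 2) * derivative f

theorem insertionOp_X_pow (n r : ℕ) :
    insertionOp n (X ^ r) = X ^ (r + 1) + (r : ℚ[X]) * X ^ r + ((n : ℚ[X]) - (r : ℚ[X])) * X ^ (r + 2) := by
  unfold insertionOp
  cases r with
  | zero => simp; ring
  | succ r => rw [derivative_X_pow, map_natCast, Nat.add_sub_cancel]; ring

theorem insertionOp_sum {ι : Type*} (n : ℕ) (s : Finset ι) (f : ι → ℚ[X]) :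
    insertionOp n (∑ i ∈ s, f i) = ∑ i ∈ s, insertionOp n (f i) := by
  simp only [insertionOp, derivative_sum, Finset.mul_sum, Finset.sum_add_distrib]

theorem insertAt_reverse {B w : List ℕ} {p : ℕ} (hp : p ≤ w.length) :
    (insertAt B p w).reverse = insertAt B.reverse (w.length - p) w.reverse := by
  simp [insertAt, List.take_reverse, List.drop_reverse, hp, Nat.sub_sub_self]

theorem insertAt_perm (B w : List ℕ) (p : ℕ) : (insertAt B p w).Perm (B ++ w) := by
  unfold insertAt
  rw [List.append_assoc]
  refine (List.perm_append_comm_assoc _ _ _).trans ?_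
  rw [List.take_append_drop]

/-- The turns in the prefix see the part after `a` only through the comparison of `a` with its
successor. -/
theorem runs_append_congr {a b b' : ℕ} {s t : List ℕ} (h : a < b ↔ a < b')
    (hr : runs (a :: b :: s) = runs (a :: b' :: t)) (u : List ℕ) :
    runs (u ++ a :: b :: s) = runs (u ++ a :: b' :: t) := by
  induction u using runs.induct with
  | case1 => simpa using hr
  | case2 x => simp [runs, hr, turn, h]
  | case3 x y => simp [runs, hr, turn, h]
  | case4 x y z u ih => simp only [List.cons_append, runs] at ih ⊢; omega

/-- The word ends with a descent. -/
def EndsWithDescent (w : List ℕ) : Prop := ∃ s a b, w = s ++ [a, b] ∧ b < a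

theorem EndsWithDescent.append_left {w : List ℕ} (h : EndsWithDescent w) (u : List ℕ) :
    EndsWithDescent (u ++ w) := by
  obtain ⟨s, a, b, rfl, hab⟩ := h
  exact ⟨u ++ s, a, b, by simp, hab⟩

/-- A suffix of two or more letters keeps the final descent; for a single letter, `M` supplies one.
-/
theorem EndsWithDescent.cons_of_append {u v : List ℕ} (h : EndsWithDescent (u ++ v)) (hv : v ≠ [])
    {M : ℕ} (hM : ∀ x ∈ v, x < M) : EndsWithDescent (M :: v) := by
  obtain ⟨s, a, b, he, hab⟩ := h
  obtain ⟨v', b', rfl⟩ := (List.eq_nil_or_concat' v).resolve_left hv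
  rcases List.eq_nil_or_concat' v' with rfl | ⟨v'', a', rfl⟩
  · exact ⟨[], M, b', rfl, hM b' (by simp)⟩
  · have he' : (u ++ v'') ++ [a', b'] = s ++ [a, b] := by simpa using he
    have := (List.append_inj' he' rfl).2
    simp only [List.cons.injEq, and_true] at this
    exact ⟨M :: v'', a', b', by simp, by omega⟩

theorem EndsWithDescent.runs_append_zero {w : List ℕ} (h : EndsWithDescent w)
    (h0 : ∀ x ∈ w, 0 < x) : runs (w ++ [0]) = runs w := by
  obtain ⟨s, a, b, rfl, hab⟩ := h
  have hb : 0 < b := h0 b (by simp)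
  rw [List.append_assoc]
  exact (runs_append_three s a b 0).trans (by rw [turn_eq_zero (by omega)]; rfl)

theorem endsWithDescent_insertAt_pair {M m : ℕ} {w : List ℕ} (p : ℕ) (hM : ∀ x ∈ w, x < m)
    (hm : m < M) (hend : w = [] ∨ EndsWithDescent w) : EndsWithDescent (insertAt [M, m] p w) := by
  have e : insertAt [M, m] p w = (w.take p ++ [M]) ++ m :: w.drop p := by simp [insertAt]
  by_cases hd : w.drop p = []
  · rw [e, hd]
    exact ⟨w.take p, M, m, by simp, hm⟩
  · rw [e]
    refine EndsWithDescent.append_left ?_ _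
    have hw : EndsWithDescent (w.take p ++ w.drop p) := by
      rw [List.take_append_drop]
      exact hend.resolve_left fun h => hd (by simp [h])
    exact hw.cons_of_append hd fun x hx => hM x (List.mem_of_mem_drop hx)

/-- In front of a further letter, `m` lies inside a descent and can be dropped, while the appended
`0` only prolongs the final descent. At the end of the word, `m` and `0` play the same role. -/
theorem runs_insertAt_pair {M m : ℕ} {w : List ℕ} {p : ℕ} (hp : p ≤ w.length)
    (hM : ∀ x ∈ w, x < m) (hm : m < M) (h0 : ∀ x ∈ w, 0 < x) (hend : EndsWithDescent w) :
    runs (insertAt [M, m] p w) = runs (insertAt [M] p (w ++ [0])) := by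
  have e1 : insertAt [M, m] p w = w.take p ++ M :: m :: w.drop p := by simp [insertAt]
  have e2 : insertAt [M] p (w ++ [0]) = w.take p ++ M :: (w.drop p ++ [0]) := by
    simp [insertAt, List.take_append_of_le_length hp, List.drop_append_of_le_length hp]
  have hd : ∀ x ∈ w.drop p, x < m ∧ 0 < x := fun x hx =>
    ⟨hM x (List.mem_of_mem_drop hx), h0 x (List.mem_of_mem_drop hx)⟩
  have hw : EndsWithDescent (w.take p ++ w.drop p) := by rwa [List.take_append_drop]
  rw [e1, e2]
  generalize w.take p = u at *
  generalize w.drop p = v at *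
  cases v with
  | nil => exact runs_append_congr (b := m) (b' := 0) (s := []) (t := []) (by omega) rfl u
  | cons c v =>
    have hc := hd c (by simp)
    refine runs_append_congr (a := M) (b := m) (b' := c) (s := c :: v) (t := v ++ [0])
      (by omega) ?_ u
    have h1 : runs (M :: c :: (v ++ [0])) = runs (M :: c :: v) :=
      (hw.cons_of_append (M := M) (by simp) fun x hx => by
        have := hd x hx
        omega).runs_append_zero (by
          intro x hx
          rcases List.mem_cons.1 hx with rfl | hx
          · omega
          · exact (hd x hx).2)
    rw [h1, runs, turn_eq_zero (by omega)]
    cases v with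
    | nil => rfl
    | cons d v => simp [runs, turn, hc.1.not_gt, (hc.1.trans hm).not_gt]

/-- Inserting the descent `M m` into a word that ends with a descent. -/
theorem sum_runs_insertAt_pair {M m : ℕ} {w : List ℕ} (hne : w.Nodup)
    (hM : ∀ x ∈ w, x < m) (hm : m < M) (h0 : ∀ x ∈ w, 0 < x)
    (hend : w = [] ∨ EndsWithDescent w) :
    ∑ p ∈ Finset.range (w.length + 1), (X : ℚ[X]) ^ runs (insertAt [M, m] p w) =
      insertionOp w.length (X ^ runs w) := by
  rcases hend with rfl | hend
  · simp [insertionOp, insertAt, runs]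
  have hn0 : (w ++ [0]).Nodup := by
    rw [List.nodup_append_comm]
    exact List.nodup_cons.2 ⟨fun h => (h0 0 h).false, hne⟩
  have hn : (0 :: w.reverse).Nodup := by simpa using List.nodup_reverse.2 hn0
  -- The `0` prolongs the final descent and reversal preserves runs, which gives access to the count
  -- for words headed by `0`.
  have hr : runs (0 :: w.reverse) = runs w := by
    rw [← hend.runs_append_zero h0, ← runs_reverse hn0.isChain, List.reverse_append]; rfl
  have key := sum_runs_insertAt_zero_cons (M := M) hn.isChain (by
    intro x hx
    rcases List.mem_cons.1 hx with rfl | hx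
    · omega
    · have := hM x (by simpa using hx); omega)
  rw [List.length_reverse, hr] at key
  -- Reversal reverses the order of the slots, hence the reindexing `p ↦ w.length - p`.
  rw [insertionOp_X_pow, ← key, ← Finset.sum_range_reflect]
  refine Finset.sum_congr rfl fun p hp => ?_
  have hp : p ≤ w.length := by have := Finset.mem_range.1 hp; omega
  have hrev := insertAt_reverse (B := [M]) (p := w.length - p) (w := w ++ [0])
    (by simp; omega)
  have hnM : (insertAt [M] (w.length - p) (w ++ [0])).Nodup := by
    refine (insertAt_perm _ _ _).nodup_iff.2 (List.nodup_cons.2 ⟨fun h => ?_, hn0⟩)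
    have h : M ∈ w ++ [0] := h
    rcases List.mem_append.1 h with h | h
    · have := hM M h; omega
    · simp at h; omega
  rw [show w.length + 1 - 1 - p = w.length - p by omega,
    runs_insertAt_pair (by omega) hM hm h0 hend, ← runs_reverse hnM.isChain, hrev]
  simp only [List.length_append, List.length_cons, List.length_nil, List.reverse_append,
    List.reverse_cons, List.reverse_nil, List.nil_append, List.cons_append]
  rw [show w.length + (0 + 1) - (w.length - p) = p + 1 by omega, insertAt_cons_succ]

/-! ### Insertion as a bijection -/

theorem insertAt_filter {k N p : ℕ} {w : List ℕ} (hw : N ∉ w) :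
    (insertAt (List.replicate k N) p w).filter (· ≠ N) = w := by
  have h : ∀ l : List ℕ, N ∉ l → l.filter (· ≠ N) = l := fun l hl =>
    List.filter_eq_self.2 fun x hx => by
      simp only [ne_eq, decide_not, Bool.not_eq_true', decide_eq_false_iff_not]
      exact fun h => hl (h ▸ hx)
  have h1 : N ∉ w.take p := fun h => hw (List.mem_of_mem_take h)
  have h2 : N ∉ w.drop p := fun h => hw (List.mem_of_mem_drop h)
  rw [insertAt, List.filter_append, List.filter_append, h _ h1, h _ h2]
  simp

theorem idxOf_insertAt {k N p : ℕ} {w : List ℕ} (hw : N ∉ w) (hp : p ≤ w.length) :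
    (insertAt (List.replicate (k + 1) N) p w).idxOf N = p := by
  have h1 : N ∉ w.take p := fun h => hw (List.mem_of_mem_take h)
  rw [insertAt, List.append_assoc, List.idxOf_append_of_notMem h1, List.replicate_succ,
    List.cons_append, List.idxOf_cons_self]
  simp [hp]

/-- Deleting `N` recovers `w`, and the first position of `N` recovers `p`, so no word is produced
twice. -/
theorem sum_insertAt {k N L : ℕ} {S S' : Finset (List ℕ)} (hN : ∀ w ∈ S, N ∉ w)
    (hL : ∀ w ∈ S, w.length = L)
    (hS : ∀ τ, τ ∈ S' ↔ ∃ w ∈ S, ∃ p ≤ L, τ = insertAt (List.replicate (k + 1) N) p w)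
    (g : List ℕ → ℚ[X]) :
    ∑ τ ∈ S', g τ =
      ∑ w ∈ S, ∑ p ∈ Finset.range (L + 1), g (insertAt (List.replicate (k + 1) N) p w) := by
  rw [← Finset.sum_product']
  symm
  refine Finset.sum_bij (fun q _ => insertAt (List.replicate (k + 1) N) q.2 q.1) ?_ ?_ ?_
    fun _ _ => rfl
  · rintro ⟨w, p⟩ h
    simp only [Finset.mem_product, Finset.mem_range] at h
    exact (hS _).2 ⟨w, h.1, p, by omega, rfl⟩
  · rintro ⟨w, p⟩ h ⟨w', p'⟩ h' e
    simp only [Finset.mem_product, Finset.mem_range] at h h' e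
    have hw : w = w' := by
      rw [← insertAt_filter (hN w h.1), e, insertAt_filter (hN w' h'.1)]
    have hp : p = p' := by
      rw [← idxOf_insertAt (k := k) (hN w h.1) (p := p) (by have := hL w h.1; omega), e,
        idxOf_insertAt (hN w' h'.1) (by have := hL w' h'.1; omega)]
    rw [hw, hp]
  · intro τ hτ
    obtain ⟨w, hw, p, hp, rfl⟩ := (hS τ).1 hτ
    exact ⟨(w, p), by simp only [Finset.mem_product, Finset.mem_range]; exact ⟨hw, by omega⟩, rfl⟩

theorem coe_insertAt (B w : List ℕ) (p : ℕ) :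
    ((insertAt B p w : List ℕ) : Multiset ℕ) = (B : Multiset ℕ) + (w : Multiset ℕ) := by
  rw [Multiset.coe_add]
  exact Multiset.coe_eq_coe.2 (insertAt_perm B w p)

theorem insertAt_length_left (B u v : List ℕ) : insertAt B u.length (u ++ v) = u ++ B ++ v := by
  simp [insertAt]

/-! ### Permutations and the recurrence for `T` -/

theorem Icc_succ_val (n : ℕ) : (Finset.Icc 1 (n + 1)).val = (n + 1) ::ₘ (Finset.Icc 1 n).val := by
  rw [← Finset.insert_val_of_notMem (by simp)]
  congr 1
  ext x
  simp
  omega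

theorem mem_perms {n : ℕ} {w : List ℕ} :
    w ∈ perms n ↔ (w : Multiset ℕ) = (Finset.Icc 1 n).val := by
  simp [perms, Multiset.mem_lists_iff, eq_comm]

theorem mem_perms_succ {n : ℕ} (τ : List ℕ) :
    τ ∈ perms (n + 1) ↔ ∃ w ∈ perms n, ∃ p ≤ n,
      τ = insertAt (List.replicate (0 + 1) (n + 1)) p w := by
  have hlen : ∀ w ∈ perms n, w.length = n := fun w hw => by
    have := congrArg Multiset.card (mem_perms.1 hw)
    simpa using this
  rw [mem_perms, Icc_succ_val]
  constructor
  · intro h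
    have hm : n + 1 ∈ τ := by rw [← Multiset.mem_coe, h]; simp
    obtain ⟨u, v, rfl⟩ := List.append_of_mem hm
    have hw : u ++ v ∈ perms n := by
      rw [mem_perms, ← Multiset.cons_inj_right (n + 1), ← h]
      exact Multiset.coe_eq_coe.2 List.perm_middle.symm
    have := hlen _ hw
    refine ⟨u ++ v, hw, u.length, ?_, ?_⟩
    · simp at this; omega
    · rw [insertAt_length_left]; simp
  · rintro ⟨w, hw, p, -, rfl⟩
    rw [coe_insertAt, mem_perms.1 hw]
    simp

theorem mem_of_mem_perms {n x : ℕ} {w : List ℕ} (hw : w ∈ perms n) (hx : x ∈ w) :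
    1 ≤ x ∧ x ≤ n := by
  rw [← Multiset.mem_coe, mem_perms.1 hw] at hx
  simpa using hx

theorem T_zero : T 0 = 1 := by
  have : perms 0 = {[]} := by
    ext w
    rw [mem_perms]
    simp
  simp [T, this, udrun, altrun_eq_runs, runs]

theorem T_succ (n : ℕ) : T (n + 1) = insertionOp n (T n) := by
  have hnd : ∀ m, ∀ w ∈ perms m, (0 :: w).Nodup := fun m w hw => by
    refine List.nodup_cons.2 ⟨fun h => ?_, ?_⟩
    · have := mem_of_mem_perms hw h; omega
    · rw [← Multiset.coe_nodup, mem_perms.1 hw]; exact Finset.nodup _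
  have hT : ∀ m, T m = ∑ w ∈ perms m, X ^ runs (0 :: w) := fun m =>
    Finset.sum_congr rfl fun w hw => by rw [udrun, altrun_eq_runs (hnd m w hw).isChain]
  have hlen : ∀ w ∈ perms n, w.length = n := fun w hw => by
    have := congrArg Multiset.card (mem_perms.1 hw)
    simpa using this
  rw [hT, hT, sum_insertAt (fun w hw h => by have := mem_of_mem_perms hw h; omega) hlen
    mem_perms_succ, insertionOp_sum]
  refine Finset.sum_congr rfl fun w hw => ?_
  have := sum_runs_insertAt_zero_cons (M := n + 1) (hnd n w hw).isChain (by
    intro x hx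
    rcases List.mem_cons.1 hx with rfl | hx
    · omega
    · have := mem_of_mem_perms hw hx; omega)
  rw [hlen w hw] at this
  rw [insertionOp_X_pow, ← this]
  rfl

/-! ### Stirling permutations, their duals and the recurrence for `F` -/

theorem mem_stirlingPerms {n : ℕ} {σ : List ℕ} :
    σ ∈ stirlingPerms n ↔ (σ : Multiset ℕ) = doubledMultiset n ∧
      ∀ i a : ℕ, List.Sublist [i, a, i] σ → i < a := by
  simp [stirlingPerms, Multiset.mem_lists_iff, eq_comm]

theorem doubledMultiset_succ (n : ℕ) :
    doubledMultiset (n + 1) = (n + 1) ::ₘ (n + 1) ::ₘ doubledMultiset n := by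
  simp [doubledMultiset, Icc_succ_val]

theorem mem_of_mem_stirlingPerms {n x : ℕ} {w : List ℕ} (hw : w ∈ stirlingPerms n) (hx : x ∈ w) :
    1 ≤ x ∧ x ≤ n := by
  rw [← Multiset.mem_coe, (mem_stirlingPerms.1 hw).1] at hx
  simpa [doubledMultiset] using hx

theorem length_of_mem_stirlingPerms {n : ℕ} {w : List ℕ} (hw : w ∈ stirlingPerms n) :
    w.length = 2 * n := by
  have := congrArg Multiset.card (mem_stirlingPerms.1 hw).1
  simpa [doubledMultiset, two_mul] using this

/-- No letter exceeds `n + 1`, so nothing can stand between its two copies. Conversely, an adjacent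
pair of maxima creates no forbidden pattern. -/
theorem mem_stirlingPerms_succ {n : ℕ} (τ : List ℕ) :
    τ ∈ stirlingPerms (n + 1) ↔ ∃ w ∈ stirlingPerms n, ∃ p ≤ 2 * n,
      τ = insertAt (List.replicate (1 + 1) (n + 1)) p w := by
  constructor
  · intro h
    obtain ⟨hm, hs⟩ := mem_stirlingPerms.1 h
    have hN : n + 1 ∈ τ := by rw [← Multiset.mem_coe, hm, doubledMultiset_succ]; simp
    obtain ⟨u, τ', rfl, hu⟩ := List.eq_append_cons_of_mem hN
    have hm1 : ((u ++ τ' : List ℕ) : Multiset ℕ) = (n + 1) ::ₘ doubledMultiset n := by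
      rw [← Multiset.cons_inj_right (n + 1), ← doubledMultiset_succ, ← hm]
      exact Multiset.coe_eq_coe.2 List.perm_middle.symm
    have hN' : n + 1 ∈ u ++ τ' := by rw [← Multiset.mem_coe, hm1]; simp
    obtain ⟨v, t, rfl, hv⟩ := List.eq_append_cons_of_mem ((List.mem_append.1 hN').resolve_left hu)
    obtain rfl : v = [] := by
      cases v with
      | nil => rfl
      | cons x v =>
        have h1 := hs (n + 1) x (by
          refine (List.Sublist.trans ?_ (List.sublist_append_right _ _))
          refine List.Sublist.cons_cons _ (List.Sublist.cons_cons _ ?_)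
          exact List.singleton_sublist.2 (by simp))
        have h2 := mem_of_mem_stirlingPerms h (x := x) (by simp)
        omega
    have hw : u ++ t ∈ stirlingPerms n := by
      refine mem_stirlingPerms.2 ⟨?_, fun i a hia => hs i a (hia.trans ?_)⟩
      · rw [← Multiset.cons_inj_right (n + 1), ← hm1]
        exact Multiset.coe_eq_coe.2 List.perm_middle.symm
      · exact List.Sublist.append_left
          ((List.sublist_cons_self _ _).trans (List.sublist_cons_self _ _)) _
    have := length_of_mem_stirlingPerms hw
    refine ⟨u ++ t, hw, u.length, ?_, ?_⟩
    · simp at this; omega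
    · rw [insertAt_length_left]; simp
  · rintro ⟨w, hw, p, -, rfl⟩
    have hN : n + 1 ∉ w := fun h => by have := mem_of_mem_stirlingPerms hw h; omega
    refine mem_stirlingPerms.2 ⟨?_, fun i a hia => ?_⟩
    · rw [coe_insertAt, (mem_stirlingPerms.1 hw).1, doubledMultiset_succ]
      change ((([n + 1, n + 1] : List ℕ) : Multiset ℕ)) + _ = _
      rw [← Multiset.cons_coe, ← Multiset.cons_coe, Multiset.coe_nil, Multiset.cons_add,
        Multiset.cons_add, zero_add]
    · have hle : ∀ x ∈ insertAt (List.replicate (1 + 1) (n + 1)) p w, x ≤ n + 1 := by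
        intro x this
        rw [← Multiset.mem_coe, coe_insertAt, Multiset.mem_add, Multiset.mem_coe,
          Multiset.mem_coe] at this
        rcases this with h | h
        · exact (List.eq_of_mem_replicate h).le
        · have := mem_of_mem_stirlingPerms hw h; omega
      by_cases hi : i = n + 1
      · exfalso
        subst hi
        have h1 : n + 1 ∉ w.take p := fun h => hN (List.mem_of_mem_take h)
        have h2 : n + 1 ∉ w.drop p := fun h => hN (List.mem_of_mem_drop h)
        rw [insertAt, List.append_assoc, List.sublist_append_iff] at hia
        obtain ⟨s, s', he, hs, hs'⟩ := hia
        cases s with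
        | cons x s =>
          rw [List.cons_append, List.cons.injEq] at he
          exact h1 (hs.subset (by simp [he.1]))
        | nil =>
          rw [List.nil_append] at he
          subst he
          simp only [List.replicate_succ, List.replicate_zero, List.cons_append, List.nil_append,
            List.cons_sublist_cons] at hs'
          rcases List.sublist_cons_iff.1 hs' with h | ⟨r, hr, h⟩
          · exact h2 (h.subset (by simp))
          · rw [List.cons.injEq] at hr
            exact h2 (h.subset (by simp [← hr.2]))
      · by_cases ha' : a = n + 1
        · have := hle i (hia.subset (by simp))
          omega
        · refine (mem_stirlingPerms.1 hw).2 i a ?_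
          -- Neither `i` nor `a` is `n + 1`, so the pattern survives the deletion of that letter and
          -- lies in `w`.
          have := hia.filter (· ≠ n + 1)
          rw [insertAt_filter hN] at this
          simpa [hi, ha'] using this

/-- The map `Φ` on a word whose letters are preceded by those of `S`. -/
def labelAfter (S : List ℕ) : List ℕ → List ℕ
  | [] => []
  | j :: l => (if j ∈ S then 2 * j - 1 else 2 * j) :: labelAfter (j :: S) l

theorem labelAfter_eq_mapIdx (S l : List ℕ) : labelAfter S l =
    l.mapIdx fun p j => if j ∈ S ∨ j ∈ l.take p then 2 * j - 1 else 2 * j := by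
  induction l generalizing S with
  | nil => rfl
  | cons a l ih =>
    rw [labelAfter, ih, List.mapIdx_cons]
    simp [or_assoc, or_left_comm]

theorem Phi_eq_labelAfter (σ : List ℕ) : Phi σ = labelAfter [] σ := by
  simp [labelAfter_eq_mapIdx, Phi]

theorem labelAfter_congr {S S' w : List ℕ} (h : ∀ x ∈ w, x ∈ S ↔ x ∈ S') :
    labelAfter S w = labelAfter S' w := by
  rw [labelAfter_eq_mapIdx, labelAfter_eq_mapIdx]
  refine List.ext_getElem (by simp) fun i h1 h2 => ?_
  simp only [List.getElem_mapIdx, h _ (List.getElem_mem _)]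

/-- `N` occurs nowhere else, so the other letters keep their labels; the set `S` of earlier letters
makes the induction possible. -/
theorem labelAfter_insertAt {N p : ℕ} {S w : List ℕ} (hS : N ∉ S) (hw : N ∉ w)
    (hp : p ≤ w.length) :
    labelAfter S (insertAt [N, N] p w) = insertAt [2 * N, 2 * N - 1] p (labelAfter S w) := by
  induction p generalizing S w with
  | zero =>
    simp only [insertAt_zero, List.cons_append, List.nil_append, labelAfter, hS, if_false,
      List.mem_cons, true_or, if_true]
    rw [labelAfter_congr (S' := S)]
    intro x hx
    have : x ≠ N := fun h => hw (h ▸ hx)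
    simp [this]
  | succ p ih =>
    cases w with
    | nil => simp at hp
    | cons a w =>
      simp only [List.mem_cons, not_or] at hw
      rw [insertAt_cons_succ, labelAfter, labelAfter, insertAt_cons_succ,
        ih (by simp [hw.1, hS]) hw.2 (by simpa using hp)]

/-- Both `2j` and `2j - 1` return to `j` under `m ↦ ⌊(m + 1)/2⌋`. -/
theorem Phi_injective : Function.Injective Phi := by
  refine Function.LeftInverse.injective (g := List.map fun m => (m + 1) / 2) fun σ => ?_
  rw [Phi]
  refine List.ext_getElem (by simp) fun i h1 h2 => ?_
  simp only [List.getElem_map, List.getElem_mapIdx]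
  split_ifs <;> omega

theorem Phi_insertAt {n p : ℕ} {σ : List ℕ} (hσ : σ ∈ stirlingPerms n) (hp : p ≤ 2 * n) :
    Phi (insertAt (List.replicate (1 + 1) (n + 1)) p σ) =
      insertAt [2 * n + 2, 2 * n + 1] p (Phi σ) := by
  rw [Phi_eq_labelAfter, Phi_eq_labelAfter]
  exact labelAfter_insertAt (by simp)
    (fun h => by have := mem_of_mem_stirlingPerms hσ h; omega)
    (by rw [length_of_mem_stirlingPerms hσ]; exact hp)

theorem stirlingPerms_zero : stirlingPerms 0 = {[]} := by
  ext w
  rw [mem_stirlingPerms]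
  simp only [doubledMultiset]
  constructor
  · rintro ⟨h, -⟩; simpa using h
  · intro h; rw [Finset.mem_singleton] at h; subst h; simp

theorem Phi_properties {n : ℕ} : ∀ σ ∈ stirlingPerms n, (Phi σ).Nodup ∧
    (∀ x ∈ Phi σ, 0 < x ∧ x < 2 * n + 1) ∧ (Phi σ = [] ∨ EndsWithDescent (Phi σ)) := by
  induction n with
  | zero =>
    intro σ hσ
    rw [stirlingPerms_zero, Finset.mem_singleton] at hσ
    subst hσ
    simp [Phi]
  | succ n ih =>
    intro τ hτ
    obtain ⟨σ, hσ, p, hp, rfl⟩ := (mem_stirlingPerms_succ τ).1 hτ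
    obtain ⟨h1, h2, h3⟩ := ih σ hσ
    rw [Phi_insertAt hσ hp]
    have hperm := insertAt_perm [2 * n + 2, 2 * n + 1] (Phi σ) p
    refine ⟨hperm.nodup_iff.2 ?_, fun x hx => ?_, Or.inr ?_⟩
    · rw [List.cons_append, List.cons_append, List.nil_append, List.nodup_cons, List.nodup_cons,
        List.mem_cons]
      refine ⟨fun h => ?_, fun h => ?_, h1⟩
      · rcases h with h | h
        · omega
        · have := h2 _ h; omega
      · have := h2 _ h; omega
    · have := hperm.mem_iff.1 hx
      simp only [List.cons_append, List.nil_append, List.mem_cons] at this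
      rcases this with h | h | h
      · omega
      · omega
      · have := h2 _ h; omega
    · exact endsWithDescent_insertAt_pair p (fun x hx => (h2 x hx).2) (by omega) h3

theorem F_eq_sum_runs (n : ℕ) : F n = ∑ σ ∈ stirlingPerms n, X ^ runs (Phi σ) := by
  rw [F, dualStirlingPerms, Finset.sum_image fun _ _ _ _ h => Phi_injective h]
  exact Finset.sum_congr rfl fun σ hσ => by
    rw [altrun_eq_runs (Phi_properties σ hσ).1.isChain]

theorem F_zero : F 0 = 1 := by
  rw [F_eq_sum_runs, stirlingPerms_zero]
  simp [Phi, runs]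

theorem F_succ (n : ℕ) : F (n + 1) = insertionOp (2 * n) (F n) := by
  rw [F_eq_sum_runs, F_eq_sum_runs,
    sum_insertAt (fun w hw h => by have := mem_of_mem_stirlingPerms hw h; omega)
      (fun w => length_of_mem_stirlingPerms) mem_stirlingPerms_succ, insertionOp_sum]
  refine Finset.sum_congr rfl fun σ hσ => ?_
  obtain ⟨h1, h2, h3⟩ := Phi_properties σ hσ
  have hlen : (Phi σ).length = 2 * n := by
    rw [Phi, List.length_mapIdx, length_of_mem_stirlingPerms hσ]
  have := sum_runs_insertAt_pair (M := 2 * n + 2) h1 (fun x hx => (h2 x hx).2) (by omega)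
    (fun x hx => (h2 x hx).1) h3
  rw [hlen] at this
  rw [← this]
  refine Finset.sum_congr rfl fun p hp => ?_
  rw [Phi_insertAt hσ (by have := Finset.mem_range.1 hp; omega)]

/-! ### First-order linear differential equations for power series -/

section PDE

variable {R : Type*} [CommRing R] [Algebra ℚ R]

/-- The coefficientwise extension of a derivation to formal power series. -/
def coeffwise (δ : Derivation ℚ R R) (f : PowerSeries R) : PowerSeries R :=
  PowerSeries.mk fun n => δ (PowerSeries.coeff n f)

@[simp] theorem coeff_coeffwise (δ : Derivation ℚ R R) (f : PowerSeries R) (n : ℕ) :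
    PowerSeries.coeff n (coeffwise δ f) = δ (PowerSeries.coeff n f) := by simp [coeffwise]

theorem coeffwise_add (δ : Derivation ℚ R R) (f g : PowerSeries R) :
    coeffwise δ (f + g) = coeffwise δ f + coeffwise δ g := by ext n; simp

theorem coeffwise_mul (δ : Derivation ℚ R R) (f g : PowerSeries R) :
    coeffwise δ (f * g) = f * coeffwise δ g + g * coeffwise δ f := by
  ext n
  rw [mul_comm g]
  simp only [coeff_coeffwise, map_add, PowerSeries.coeff_mul, map_sum, Derivation.leibniz,
    smul_eq_mul, ← Finset.sum_add_distrib]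
  exact Finset.sum_congr rfl fun _ _ => by ring

/-- The differential operator `(1 - b z) ∂/∂z - δ`. -/
def transport (b : R) (δ : Derivation ℚ R R) : Derivation ℚ (PowerSeries R) (PowerSeries R) where
  toFun f := (1 - PowerSeries.C b * PowerSeries.X) * PowerSeries.derivative R f - coeffwise δ f
  map_add' f g := by rw [map_add, coeffwise_add]; ring
  map_smul' q f := by
    have h1 : coeffwise δ (q • f) = q • coeffwise δ f := by ext n; simp
    have h2 : PowerSeries.derivative R (q • f) = q • PowerSeries.derivative R f := by
      ext n; simp [PowerSeries.coeff_derivative]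
    simp only [h1, h2, RingHom.id_apply, smul_sub, mul_smul_comm]
  map_one_eq_zero' := by
    have : coeffwise δ 1 = 0 := by
      ext n; simp only [coeff_coeffwise, PowerSeries.coeff_one]; split_ifs <;> simp
    simp [this]
  leibniz' f g := by
    simp
    rw [coeffwise_mul]
    ring

theorem coeff_transport (b : R) (δ : Derivation ℚ R R) (f : PowerSeries R) (n : ℕ) :
    PowerSeries.coeff n (transport b δ f) =
      ((n : R) + 1) * PowerSeries.coeff (n + 1) f - n * b * PowerSeries.coeff n f
        - δ (PowerSeries.coeff n f) := by
  have : transport b δ f = PowerSeries.derivative R f -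
    PowerSeries.C b * (PowerSeries.X * PowerSeries.derivative R f) - coeffwise δ f := by
    change (1 - PowerSeries.C b * PowerSeries.X) * PowerSeries.derivative R f - coeffwise δ f = _
    ring
  rw [this]
  simp only [map_sub, PowerSeries.coeff_C_mul, coeff_coeffwise]
  cases n with
  | zero => simp [PowerSeries.coeff_derivative]
  | succ n => simp [PowerSeries.coeff_succ_X_mul, PowerSeries.coeff_derivative]; ring

/-- The coefficient of `z^n` determines `(n + 1) f_{n+1}` from `f_n`, and `n + 1` is a unit in a
`ℚ`-algebra. -/
theorem transport_unique {b c : R} {δ : Derivation ℚ R R} {f g : PowerSeries R}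
    (h0 : PowerSeries.constantCoeff f = PowerSeries.constantCoeff g)
    (hf : transport b δ f = PowerSeries.C c * f) (hg : transport b δ g = PowerSeries.C c * g) :
    f = g := by
  ext n
  induction n with
  | zero => simpa using h0
  | succ n ih =>
    have h1 := congrArg (PowerSeries.coeff n) hf
    have h2 := congrArg (PowerSeries.coeff n) hg
    rw [coeff_transport, PowerSeries.coeff_C_mul] at h1 h2
    rw [ih] at h1
    have hu : IsUnit ((n : R) + 1) := by
      have : ((n : R) + 1) = algebraMap ℚ R ((n : ℚ) + 1) := by simp
      rw [this]
      exact (IsUnit.mk0 _ (by positivity)).map _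
    exact hu.mul_left_cancel (by linear_combination h1 - h2)

theorem transport_mk {b c : R} {δ : Derivation ℚ R R} {p : ℕ → R}
    (h : ∀ n, p (n + 1) = (c + n * b) * p n + δ (p n)) :
    transport b δ (PowerSeries.mk fun n => algebraMap ℚ R ((n ! : ℚ)⁻¹) * p n) =
      PowerSeries.C c * PowerSeries.mk fun n => algebraMap ℚ R ((n ! : ℚ)⁻¹) * p n := by
  ext n
  rw [coeff_transport, PowerSeries.coeff_C_mul]
  simp only [PowerSeries.coeff_mk]
  have h1 : ((n : R) + 1) * algebraMap ℚ R (((n + 1)! : ℚ)⁻¹) = algebraMap ℚ R ((n ! : ℚ)⁻¹) := by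
    have : ((n : R) + 1) = algebraMap ℚ R ((n : ℚ) + 1) := by simp
    rw [this, ← map_mul, Nat.factorial_succ]
    have h0 : (n ! : ℚ) ≠ 0 := by positivity
    refine congrArg (algebraMap ℚ R) ?_
    push_cast
    field_simp
  have h2 : δ (algebraMap ℚ R ((n ! : ℚ)⁻¹) * p n) = algebraMap ℚ R ((n ! : ℚ)⁻¹) * δ (p n) := by
    rw [Derivation.leibniz]; simp
  rw [← mul_assoc, h1, h2, h]
  ring

end PDE

/-! ### The square of the generating function of the `f_n` -/

theorem egf_eq_mk (p : ℕ → ℚ[X]) :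
    egf p = PowerSeries.mk fun n => algebraMap ℚ ℚ[X] ((n ! : ℚ)⁻¹) * p n := rfl

/-- The derivation `q(x) d/dx` of polynomials. -/
def polyDer (q : ℚ[X]) : Derivation ℚ ℚ[X] ℚ[X] := q • Polynomial.derivative'

@[simp] theorem polyDer_apply (q p : ℚ[X]) : polyDer q p = q * Polynomial.derivative p := rfl

/-- Substituting `2x` turns `x(1-x²) d/dx` into `x(1-4x²) d/dx`, the derivation in the recurrence of
`p`. Both sides then solve the equation with `b = 4x²`, `c = 2x`. -/
theorem egf_sq_eq {p t : ℕ → ℚ[X]} (hp0 : p 0 = 1) (ht0 : t 0 = 1)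
    (hp : ∀ n, p (n + 1) = (X + 4 * (n : ℚ[X]) * X ^ 2) * p n + X * (1 - 4 * X ^ 2) * derivative (p n))
    (ht : ∀ n, t (n + 1) = X * ((n : ℚ[X]) * X + 1) * t n + X * (1 - X ^ 2) * derivative (t n)) :
    egf p ^ 2 = substTwoX (egf t) := by
  have e : substTwoX (egf t) = egf fun n => (t n).comp (2 * X) := by
    ext1 n
    simp [substTwoX, egf]
  have hs : ∀ n, (t (n + 1)).comp (2 * X) =
      (2 * X + (n : ℚ[X]) * (4 * X ^ 2)) * (t n).comp (2 * X) +
        polyDer (X * (1 - 4 * X ^ 2)) ((t n).comp (2 * X)) := fun n => by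
    rw [ht, polyDer_apply, derivative_comp]
    simp
    ring
  have hp' : ∀ n, p (n + 1) =
      (X + (n : ℚ[X]) * (4 * X ^ 2)) * p n + polyDer (X * (1 - 4 * X ^ 2)) (p n) := fun n => by
    rw [hp, polyDer_apply]; ring
  rw [e]
  refine transport_unique (b := 4 * X ^ 2) (c := 2 * X) (δ := polyDer (X * (1 - 4 * X ^ 2)))
    ?_ ?_ (transport_mk hs)
  · simp [egf, hp0, ht0]
  · rw [Derivation.leibniz_pow, egf_eq_mk, transport_mk hp']
    have h2 : (PowerSeries.C (2 : ℚ[X]) : PowerSeries ℚ[X]) = 2 := map_ofNat _ 2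
    simp only [nsmul_eq_mul, smul_eq_mul, map_mul, h2]
    push_cast
    ring

/-! ### The closed form of `T(x,z)` -/

/-- The derivation `x (1 - x²) d/dx` of power series. -/
def seriesDer : Derivation ℚ (PowerSeries ℚ) (PowerSeries ℚ) :=
  ((PowerSeries.X : PowerSeries ℚ) * (1 - PowerSeries.X ^ 2)) • PowerSeries.derivative ℚ

theorem seriesDer_apply (f : PowerSeries ℚ) :
    seriesDer f = PowerSeries.X * (1 - PowerSeries.X ^ 2) * PowerSeries.derivative ℚ f := rfl

theorem seriesDer_X : seriesDer PowerSeries.X = PowerSeries.X * (1 - PowerSeries.X ^ 2) := by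
  rw [seriesDer_apply]; simp

theorem rho_ne_zero : rho ≠ 0 := fun h => by
  have := constantCoeff_rho
  rw [h] at this
  simp at this

theorem seriesDer_rho : seriesDer rho = -(PowerSeries.X ^ 2 * rho) := by
  have h := congrArg seriesDer rho_sq
  rw [Derivation.leibniz_pow, map_sub, Derivation.leibniz_pow, seriesDer_X,
    Derivation.map_one_eq_zero, ← rho_sq] at h
  simp only [nsmul_eq_mul, smul_eq_mul] at h
  refine mul_left_cancel₀ (mul_ne_zero (a := (2 : PowerSeries ℚ)) ?_ rho_ne_zero) ?_
  · exact fun h => by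
      have := congrArg PowerSeries.constantCoeff h
      rw [map_ofNat, map_zero] at this
      norm_num at this
  push_cast at h
  linear_combination h

/-- The operator `(1 - x² z) ∂/∂z - x (1 - x²) ∂/∂x` on `ℚ⟦x⟧⟦z⟧`. -/
abbrev stanleyOp := transport (PowerSeries.X ^ 2) seriesDer

theorem transport_C {R : Type*} [CommRing R] [Algebra ℚ R] (b : R) (δ : Derivation ℚ R R) (a : R) :
    transport b δ (PowerSeries.C a) = PowerSeries.C (-δ a) := by
  ext n
  rw [coeff_transport]
  cases n with
  | zero => simp [PowerSeries.coeff_C]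
  | succ n => simp

theorem stanleyOp_xx : stanleyOp xx = -(xx * rr ^ 2) := by
  rw [xx, rr, transport_C, seriesDer_X, ← rho_sq]; simp

theorem stanleyOp_rr : stanleyOp rr = xx ^ 2 * rr := by
  rw [xx, rr, transport_C, seriesDer_rho]; simp

/-- The contribution `-x²zρe^{ρz}` of the `z`-derivative cancels against that of `δρ = -x²ρ`. -/
theorem stanleyOp_expz : stanleyOp (expz rho) = rr * expz rho := by
  have : expz rho = PowerSeries.mk fun n =>
      algebraMap ℚ (PowerSeries ℚ) ((n ! : ℚ)⁻¹) * rho ^ n := by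
    ext1 n
    simp [expz, PowerSeries.coeff_rescale, PowerSeries.coeff_exp, mul_comm]
  rw [this, rr]
  refine transport_mk fun n => ?_
  rw [Derivation.leibniz_pow, seriesDer_rho]
  cases n with
  | zero => simp
  | succ n => simp [pow_succ]; ring

theorem constantCoeff_expz (a : PowerSeries ℚ) : PowerSeries.constantCoeff (expz a) = 1 := by
  rw [← PowerSeries.coeff_zero_eq_constantCoeff_apply, expz, PowerSeries.coeff_rescale,
    PowerSeries.coeff_exp]
  simp

theorem expz_two_mul : expz (2 * rho) = expz rho ^ 2 := by
  rw [expz, expz, pow_two, two_mul, PowerSeries.exp_mul_exp_eq_exp_add]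

theorem rr_sq : rr ^ 2 = 1 - xx ^ 2 := by
  rw [rr, xx, ← map_pow, rho_sq]; simp

theorem stanleyT_mul_stanleyDen : stanleyT * stanleyDen = stanleyNum := by
  rw [stanleyT, mul_assoc, IsUnit.val_inv_mul, mul_one]

theorem stanleyOp_stanleyT : stanleyOp stanleyT = xx * stanleyT := by
  have h := congrArg stanleyOp stanleyT_mul_stanleyDen
  refine (isUnit_stanleyDen.pow 2).mul_left_cancel ?_
  have e := stanleyT_mul_stanleyDen
  have key : stanleyDen * stanleyOp stanleyNum - stanleyNum * stanleyOp stanleyDen =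
      xx * stanleyNum * stanleyDen := by
    have hx := stanleyOp_xx
    have hr := stanleyOp_rr
    have hE := stanleyOp_expz
    have hs := rr_sq
    have h2 : stanleyOp 2 = 0 := by
      have := stanleyOp.map_natCast 2
      simpa using this
    simp only [stanleyNum, stanleyDen, expz_two_mul, Derivation.leibniz, Derivation.leibniz_pow,
      map_add, map_sub, Derivation.map_one_eq_zero, hx, hr, hE, smul_eq_mul, nsmul_eq_mul, h2]
    -- What remains is a polynomial identity in `x, r, E` modulo `r² = 1 - x²`.
    generalize expz rho = E at *
    generalize xx = x at *
    generalize rr = r at *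
    push_cast
    grind
  rw [Derivation.leibniz, smul_eq_mul, smul_eq_mul] at h
  linear_combination stanleyDen * h + key + (xx * stanleyDen + stanleyOp stanleyDen) * e * (-1)

theorem toSeries_egf_eq_stanleyT {t : ℕ → ℚ[X]} (ht0 : t 0 = 1)
    (ht : ∀ n, t (n + 1) = X * ((n : ℚ[X]) * X + 1) * t n + X * (1 - X ^ 2) * derivative (t n)) :
    toSeries (egf t) = stanleyT := by
  have e : toSeries (egf t) = PowerSeries.mk fun n =>
      algebraMap ℚ (PowerSeries ℚ) ((n ! : ℚ)⁻¹) * (t n : PowerSeries ℚ) := by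
    ext1 n
    simp [toSeries, egf]
  rw [e]
  refine transport_unique (b := PowerSeries.X ^ 2) (c := PowerSeries.X) (δ := seriesDer)
    ?_ (transport_mk fun n => ?_) stanleyOp_stanleyT
  · have h := congrArg PowerSeries.constantCoeff stanleyT_mul_stanleyDen
    rw [map_mul] at h
    have h2 : PowerSeries.constantCoeff (2 : PowerSeries (PowerSeries ℚ)) = 2 := map_ofNat _ 2
    simp only [stanleyDen, stanleyNum, xx, rr, map_add, map_sub, map_mul, map_pow, map_one,
      PowerSeries.constantCoeff_C, constantCoeff_expz, h2] at h
    -- At `z = 0` numerator and denominator both equal `2 - 2x²`.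
    have hu : (2 - 2 * PowerSeries.X ^ 2 : PowerSeries ℚ) ≠ 0 := fun h => by
      have := congrArg PowerSeries.constantCoeff h
      simp only [map_sub, map_mul, map_pow, PowerSeries.constantCoeff_X, map_ofNat, map_zero] at this
      norm_num at this
    have h1 : PowerSeries.constantCoeff stanleyT = 1 :=
      mul_left_cancel₀ hu (by linear_combination h)
    rw [h1, ← PowerSeries.coeff_zero_eq_constantCoeff_apply, PowerSeries.coeff_mk, ht0]
    simp
  · rw [ht, seriesDer_apply, PowerSeries.derivative_coe]
    have hn : ((n : ℚ[X]) : PowerSeries ℚ) = n := map_natCast coeToPowerSeries.ringHom n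
    push_cast [hn]
    ring

/-! ### The coefficients `f_{n,k}` and the expansion of `F` -/

/-- The coefficients `f_{n,k}` given by the three-term recurrence. -/
def fcoeff : ℕ → ℤ → ℚ
  | 0, k => if k = 0 then 1 else 0
  | n + 1, k => k * fcoeff n k + fcoeff n (k - 1) + 4 * ((n : ℚ) - k + 2) * fcoeff n (k - 2)

theorem fcoeff_eq_zero (n : ℕ) (k : ℤ) (h : k < 0 ∨ (n : ℤ) < k) : fcoeff n k = 0 := by
  induction n generalizing k with
  | zero => rw [fcoeff, if_neg (by omega)]
  | succ n ih =>
    push_cast at h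
    rw [fcoeff, ih k (by omega), ih (k - 1) (by omega)]
    -- For `k = n + 2` the value `f_{n,n}` may be nonzero, but its factor `n - k + 2` vanishes.
    by_cases h2 : k = n + 2
    · subst h2; push_cast; ring
    · rw [ih (k - 2) (by omega)]; ring

theorem fcoeff_nonneg (n : ℕ) (k : ℤ) : 0 ≤ fcoeff n k := by
  induction n generalizing k with
  | zero => rw [fcoeff]; split_ifs <;> simp
  | succ n ih =>
    rw [fcoeff]
    have h1 : 0 ≤ (k : ℚ) * fcoeff n k := by
      by_cases hk : k < 0
      · rw [fcoeff_eq_zero n k (Or.inl hk), mul_zero]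
      · have : (0 : ℚ) ≤ k := by exact_mod_cast (by omega : (0 : ℤ) ≤ k)
        exact mul_nonneg this (ih k)
    have h2 : 0 ≤ 4 * ((n : ℚ) - k + 2) * fcoeff n (k - 2) := by
      by_cases hk : (n : ℤ) < k - 2
      · rw [fcoeff_eq_zero n _ (Or.inr hk), mul_zero]
      · have : (0 : ℚ) ≤ (n : ℚ) - k + 2 := by
          exact_mod_cast (by omega : (0 : ℤ) ≤ (n : ℤ) - k + 2)
        exact mul_nonneg (by positivity) (ih _)
    have := ih (k - 1)
    positivity

theorem fcoeff_zero_right (n : ℕ) (hn : 1 ≤ n) : fcoeff n 0 = 0 := by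
  obtain ⟨m, rfl⟩ := Nat.exists_eq_add_of_le' hn
  rw [fcoeff, fcoeff_eq_zero m (0 - 1) (by omega), fcoeff_eq_zero m (0 - 2) (by omega)]
  simp

/-- The polynomials `f_n(x) = ∑ f_{n,k} x^k`. -/
def fpoly (n : ℕ) : ℚ[X] := ∑ k ∈ Finset.range (n + 1), C (fcoeff n k) * X ^ k

theorem coeff_fpoly (n k : ℕ) : (fpoly n).coeff k = fcoeff n k := by
  rw [fpoly, finsetSum_coeff]
  simp only [coeff_C_mul, coeff_X_pow, mul_ite, mul_one, mul_zero, Finset.sum_ite_eq,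
    Finset.mem_range]
  split_ifs with h
  · rfl
  · rw [fcoeff_eq_zero n k (by omega)]

theorem fpoly_zero : fpoly 0 = 1 := by simp [fpoly, fcoeff]

theorem C_four : (C 4 : ℚ[X]) = 4 := map_ofNat C 4

theorem fpoly_succ (n : ℕ) :
    fpoly (n + 1) = (X + 4 * (n : ℚ[X]) * X ^ 2) * fpoly n
      + X * (1 - 4 * X ^ 2) * derivative (fpoly n) := by
  have e : (X + 4 * (n : ℚ[X]) * X ^ 2) * fpoly n + X * (1 - 4 * X ^ 2) * derivative (fpoly n) =
      X * (fpoly n + X * (C (4 * (n : ℚ)) * fpoly n - C 4 * (X * derivative (fpoly n))))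
        + X * derivative (fpoly n) := by
    rw [C_mul, C_four, map_natCast]
    ring
  have hd : ∀ k : ℕ, (X * derivative (fpoly n)).coeff k = k * fcoeff n k := fun k => by
    cases k with
    | zero => simp
    | succ k => rw [coeff_X_mul, coeff_derivative, coeff_fpoly]; push_cast; ring
  rw [e]
  ext k
  rw [coeff_add, hd, coeff_fpoly, fcoeff]
  match k with
  | 0 =>
    rw [fcoeff_eq_zero n (_ - 1) (by omega), fcoeff_eq_zero n (_ - 2) (by omega)]
    simp
  | 1 =>
    rw [fcoeff_eq_zero n (_ - 2) (by omega), coeff_X_mul, coeff_add, coeff_fpoly]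
    simp
    ring
  | k + 2 =>
    rw [coeff_X_mul, coeff_add, coeff_fpoly, coeff_X_mul, coeff_sub, coeff_C_mul, coeff_C_mul, hd,
      coeff_fpoly]
    push_cast
    rw [show (k : ℤ) + 2 - 1 = k + 1 by ring, show (k : ℤ) + 2 - 2 = k by ring]
    ring

theorem sum_fcoeff_eq {G : ℕ → ℚ[X]} (h0 : G 0 = 1)
    (h : ∀ n : ℕ, G (n + 1) =
      X * (1 + 2 * (n : ℚ[X]) * X) * G n + X * (1 - X ^ 2) * derivative (G n)) (n : ℕ) :
    G n = ∑ k ∈ Finset.range (n + 1), C (fcoeff n k) * X ^ k * (1 + X ^ 2) ^ (n - k) := by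
  induction n with
  | zero => simp [h0, fcoeff]
  | succ n ih =>
    -- This rests on `k(1-x²) = k(1+x²) - 2kx²` and `(1+x²) + (1-x²) = 2`. At `k = n` the truncated
    -- exponent `n - 1 - k` is harmless, since its factor `n - k` is zero.
    have hb : ∀ k ∈ Finset.range (n + 1),
        X * (1 + 2 * (n : ℚ[X]) * X) * (C (fcoeff n k) * X ^ k * (1 + X ^ 2) ^ (n - k))
          + X * (1 - X ^ 2) * derivative (C (fcoeff n k) * X ^ k * (1 + X ^ 2) ^ (n - k)) =
        C (k * fcoeff n k) * X ^ k * (1 + X ^ 2) ^ (n + 1 - k)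
          + C (fcoeff n k) * X ^ (k + 1) * (1 + X ^ 2) ^ (n - k)
          + C (4 * ((n : ℚ) - k) * fcoeff n k) * X ^ (k + 2) * (1 + X ^ 2) ^ (n - 1 - k) := by
      intro k hk
      obtain ⟨m, rfl⟩ : ∃ m, n = k + m := ⟨n - k, by have := Finset.mem_range.1 hk; omega⟩
      have hX : X * derivative (X ^ k : ℚ[X]) = (k : ℚ[X]) * X ^ k := by
        cases k with
        | zero => simp
        | succ k => rw [derivative_X_pow, map_natCast, Nat.add_sub_cancel]; ring
      rw [show k + m - k = m by omega, show k + m + 1 - k = m + 1 by omega,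
        show k + m - 1 - k = m - 1 by omega]
      simp only [derivative_mul, derivative_C, derivative_pow, derivative_add, derivative_one,
        derivative_X, map_mul, map_sub, map_natCast, C_four] at hX ⊢
      cases m with
      | zero =>
        simp
        linear_combination C (fcoeff k k) * (1 - X ^ 2) * hX
      | succ m =>
        simp
        linear_combination C (fcoeff (k + (m + 1)) k) * (1 - X ^ 2) * (1 + X ^ 2) ^ (m + 1) * hX
    rw [h, ih, derivative_sum, Finset.mul_sum, Finset.mul_sum, ← Finset.sum_add_distrib,
      Finset.sum_congr rfl hb, Finset.sum_add_distrib, Finset.sum_add_distrib]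
    have hr : ∀ k ∈ Finset.range (n + 1 + 1),
        C (fcoeff (n + 1) k) * X ^ k * (1 + X ^ 2) ^ (n + 1 - k) =
        C (k * fcoeff n k) * X ^ k * (1 + X ^ 2) ^ (n + 1 - k)
        + C (fcoeff n ((k : ℤ) - 1)) * X ^ k * (1 + X ^ 2) ^ (n + 1 - k)
        + C (4 * ((n : ℚ) - k + 2) * fcoeff n ((k : ℤ) - 2)) * X ^ k * (1 + X ^ 2) ^ (n + 1 - k) :=
      fun k _ => by rw [fcoeff, C_add, C_add]; push_cast; ring
    rw [Finset.sum_congr rfl hr, Finset.sum_add_distrib, Finset.sum_add_distrib]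
    -- The three sums match after shifts of `k` by 0, 1 and 2; the boundary terms vanish.
    congr 1
    · congr 1
      · rw [Finset.sum_range_succ _ (n + 1), fcoeff_eq_zero n ((n + 1 : ℕ) : ℤ) (by omega)]
        simp
      · rw [Finset.sum_range_succ' _ (n + 1), fcoeff_eq_zero n (((0 : ℕ) : ℤ) - 1) (by omega)]
        simp
    · rw [Finset.sum_range_succ, Finset.sum_range_succ' _ (n + 1), Finset.sum_range_succ',
        fcoeff_eq_zero n (((0 : ℕ) : ℤ) - 2) (by omega),
        fcoeff_eq_zero n (((0 + 1 : ℕ) : ℤ) - 2) (by omega)]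
      simp
      refine Finset.sum_congr rfl fun k hk => ?_
      have : (k : ℤ) + 1 + 1 - 2 = k := by ring
      rw [this, show n - (k + 1) = n - 1 - k by omega, show (C 2 : ℚ[X]) = 2 from map_ofNat C 2]
      ring

end DualStirling

end

/-! ### Assembly of the theorem -/

open Polynomial in
theorem mainTheorem3 :
    (∀ n : ℕ, DualStirling.IsSemiGammaPositive (DualStirling.F n)) ∧
    ∃ f : ℕ → ℤ → ℚ,
      (∀ n : ℕ, ∀ k : ℤ, k < 0 ∨ (n : ℤ) < k → f n k = 0) ∧
      (∀ n : ℕ, ∀ k : ℤ, 0 ≤ f n k) ∧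
      (∀ n : ℕ, DualStirling.F n =
        ∑ k ∈ Finset.range (n + 1), C (f n k) * X ^ k * (1 + X ^ 2) ^ (n - k)) ∧
      f 0 0 = 1 ∧
      (∀ n : ℕ, 1 ≤ n → f n 0 = 0) ∧
      (∀ n : ℕ, ∀ k : ℤ,
        f (n + 1) k = k * f n k + f n (k - 1) + 4 * ((n : ℚ) - k + 2) * f n (k - 2)) ∧
      (DualStirling.egf (fun n => ∑ k ∈ Finset.range (n + 1), C (f n k) * X ^ k)) ^ 2 =
        DualStirling.substTwoX (DualStirling.egf DualStirling.T) ∧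
      PowerSeries.constantCoeff
        (DualStirling.egf (fun n => ∑ k ∈ Finset.range (n + 1), C (f n k) * X ^ k)) = 1 ∧
      DualStirling.toSeries (DualStirling.egf DualStirling.T) = DualStirling.stanleyT := by
  have hF := DualStirling.sum_fcoeff_eq (G := DualStirling.F) DualStirling.F_zero fun n => by
    rw [DualStirling.F_succ, DualStirling.insertionOp]
    push_cast
    rfl
  have hT : ∀ n : ℕ, DualStirling.T (n + 1) = X * ((n : ℚ[X]) * X + 1) * DualStirling.T n +
      X * (1 - X ^ 2) * derivative (DualStirling.T n) := fun n => by
    rw [DualStirling.T_succ, DualStirling.insertionOp, add_comm (1 : ℚ[X])]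
  refine ⟨fun n => ⟨0, n, fun k => DualStirling.fcoeff n k, Or.inl rfl,
      fun k _ => DualStirling.fcoeff_nonneg n k, by rw [pow_zero, one_mul]; exact hF n⟩,
    DualStirling.fcoeff, DualStirling.fcoeff_eq_zero, DualStirling.fcoeff_nonneg, hF, rfl,
    DualStirling.fcoeff_zero_right, fun n k => rfl, ?_, ?_, ?_⟩
  · exact DualStirling.egf_sq_eq DualStirling.fpoly_zero DualStirling.T_zero
      DualStirling.fpoly_succ hT
  -- Constant term 1 singles out the square root among the two series with this square.
  · have h := DualStirling.fpoly_zero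
    rw [DualStirling.fpoly] at h
    simp only [DualStirling.egf, ← PowerSeries.coeff_zero_eq_constantCoeff_apply,
      PowerSeries.coeff_mk, h]
    simp
  · exact DualStirling.toSeries_egf_eq_stanleyT DualStirling.T_zero hT
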